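/- Let $T_2$ be the binary rooted tree, whose vertices are the finite words over a two-letter alphabet $\{1,2\}$ (the root is the empty word), and let $\mathrm{Aut}\,T_2$ be the group of automorphisms of $T_2$ fixing the root. For $g\in\mathrm{Aut}\,T_2$, write $\psi(g)=(g_1,g_2)\tau$ with $g_1,g_2\in\mathrm{Aut}\,T_2$ and $\tau\in\mathrm{Sym}(2)$ if $g$ maps the word $xu$ to the word $\tau(x)\,g_x(u)$ for every letter $x\in\{1,2\}$ and every word $u$; let $\sigma=(1\,2)\in\mathrm{Sym}(2)$. The Basilica group is $B=\langle a,b\rangle\le\mathrm{Aut}\,T_2$, where $\psi(a)=(1,b)$ and $\psi(b)=(1,a)\sigma$. The Brunner–Sidki–Vieira group is $H=\langle c,d\rangle\le\mathrm{Aut}\,T_2$, where $\psi(c)=(1,c)\sigma$ and $\psi(d)=(1,d^{-1})\sigma$. Then $B$ and $H$ are not isomorphic as abstract groups. -/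

import Mathlib

/-- The `d`-regular rooted tree: its vertices are the finite words over the alphabet `Fin d`
(the free monoid of rank `d`), the root is the empty word, and the immediate descendants of a
word `v` are the words `v ++ [x]` for a letter `x`. -/
def regularTree (d : ℕ) : SimpleGraph (List (Fin d)) where
  Adj v w := (∃ x, w = v ++ [x]) ∨ (∃ x, v = w ++ [x])
  symm := ⟨fun _ _ h => h.symm⟩
  loopless := ⟨fun v h => by simp at h⟩

/-- `Aut T_d`: the group of the graph automorphisms of the `d`-regular rooted tree that fix the
root. -/
def AutT (d : ℕ) : Subgroup (regularTree d ≃g regularTree d) where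
  carrier := {g | g [] = []}
  mul_mem' {g h} hg hh := by
    simp only [Set.mem_ofPred_eq] at hg hh ⊢
    rw [RelIso.mul_apply, hh, hg]
  one_mem' := rfl
  inv_mem' {g} hg := by
    simp only [Set.mem_ofPred_eq] at hg ⊢
    calc g⁻¹ [] = g⁻¹ (g []) := by rw [hg]
      _ = [] := RelIso.inv_apply_self g []

/-- The image of the vertex `v` under `g` (written `v ^ g` in exponential notation). -/
def AutT.app {d : ℕ} (g : AutT d) (v : List (Fin d)) : List (Fin d) := g.1 v

theorem AutT.app_ext {d : ℕ} {g h : AutT d} (H : ∀ v, AutT.app g v = AutT.app h v) : g = h :=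
  Subtype.ext (RelIso.ext H)

/-- A permutation of the words that fixes the root and that, with its inverse, maps immediate
descendants to immediate descendants is an automorphism of the rooted tree. -/
def AutT.ofWordMap {d : ℕ} (f f' : List (Fin d) → List (Fin d))
    (hl : ∀ v, f' (f v) = v) (hr : ∀ v, f (f' v) = v) (h0 : f [] = [])
    (hf : ∀ v x, ∃ y, f (v ++ [x]) = f v ++ [y])
    (hf' : ∀ v x, ∃ y, f' (v ++ [x]) = f' v ++ [y]) : AutT d :=
  ⟨{ toFun := f
     invFun := f'
     left_inv := hl
     right_inv := hr
     map_rel_iff' := by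
      intro v w
      have key : ∀ v w, (∃ x, f w = f v ++ [x]) ↔ (∃ x, w = v ++ [x]) := by
        intro v w
        constructor
        · rintro ⟨x, hx⟩
          obtain ⟨y, hy⟩ := hf' (f v) x
          exact ⟨y, by rw [← hl w, hx, hy, hl]⟩
        · rintro ⟨x, rfl⟩
          exact hf v x
      exact or_congr (key v w) (key w v) }, h0⟩

/-- An invertible automaton over the alphabet `Fin d` with set of states `S`: every state `q` has
a permutation `perm q` of the letters and, for every letter `x`, a state `next q x`. -/
structure InvAutomaton (d : ℕ) (S : Type) where
  perm : S → Equiv.Perm (Fin d)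
  next : S → Fin d → S

namespace InvAutomaton

variable {d : ℕ} {S : Type} (A : InvAutomaton d S)

/-- The transformation of words defined by a state: the first letter `x` is replaced by
`perm q x`, and the rest of the word is transformed by the state `next q x`. -/
def act : S → List (Fin d) → List (Fin d)
  | _, [] => []
  | q, x :: u => A.perm q x :: act (A.next q x) u

/-- The inverse of the transformation `act`. -/
def actInv : S → List (Fin d) → List (Fin d)
  | _, [] => []
  | q, y :: u => (A.perm q).symm y :: actInv (A.next q ((A.perm q).symm y)) u

theorem actInv_act (q : S) (v : List (Fin d)) : A.actInv q (A.act q v) = v := by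
  induction v generalizing q with
  | nil => rfl
  | cons x u ih => simp [act, actInv, ih]

theorem act_actInv (q : S) (v : List (Fin d)) : A.act q (A.actInv q v) = v := by
  induction v generalizing q with
  | nil => rfl
  | cons x u ih => simp [act, actInv, ih]

theorem act_append (q : S) (v : List (Fin d)) (x : Fin d) :
    ∃ y, A.act q (v ++ [x]) = A.act q v ++ [y] := by
  induction v generalizing q with
  | nil => exact ⟨_, rfl⟩
  | cons z u ih =>
    obtain ⟨y, hy⟩ := ih (A.next q z)
    exact ⟨y, by simp [act, hy]⟩

theorem actInv_append (q : S) (v : List (Fin d)) (x : Fin d) :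
    ∃ y, A.actInv q (v ++ [x]) = A.actInv q v ++ [y] := by
  induction v generalizing q with
  | nil => exact ⟨_, rfl⟩
  | cons z u ih =>
    obtain ⟨y, hy⟩ := ih (A.next q ((A.perm q).symm z))
    exact ⟨y, by simp [actInv, hy]⟩

/-- The automorphism of the `d`-regular rooted tree defined by a state. -/
def toAut (q : S) : AutT d :=
  AutT.ofWordMap (A.act q) (A.actInv q) (A.actInv_act q) (A.act_actInv q) rfl
    (A.act_append q) (A.actInv_append q)

end InvAutomaton

/-- `HasWreath g s t` says `ψ(g) = (s 0, …, s (d-1)) t`: the automorphism `g` acts on the first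
level by `t` and its section at the first-level vertex `x` is `s x`, that is, it maps `x u` to
`t(x) (s x)(u)` for every letter `x` and every word `u`. -/
def HasWreath {d : ℕ} (g : AutT d) (s : Fin d → AutT d) (t : Equiv.Perm (Fin d)) : Prop :=
  ∀ (x : Fin d) (u : List (Fin d)), AutT.app g (x :: u) = t x :: AutT.app (s x) u

/-- The three states of the automaton that generates the Basilica group. -/
inductive BasilicaState
  | one | a | b

/-- The automaton of the recursion `1 = (1, 1)`, `a = (1, b)`, `b = (1, a) σ`, where `σ` is the
transposition of the two letters. -/
def basilicaAutomaton : InvAutomaton 2 BasilicaState where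
  perm
    | .one => 1
    | .a => 1
    | .b => Equiv.swap 0 1
  next
    | .one => ![.one, .one]
    | .a => ![.one, .b]
    | .b => ![.one, .a]

/-- The generator `a` of the Basilica group. -/
def basilicaA : AutT 2 := basilicaAutomaton.toAut .a

/-- The generator `b` of the Basilica group. -/
def basilicaB : AutT 2 := basilicaAutomaton.toAut .b

/-- The Basilica group, generated by `a` and `b` with `ψ(a) = (1, b)` and `ψ(b) = (1, a) σ`. -/
def basilicaGroup : Subgroup (AutT 2) := Subgroup.closure {basilicaA, basilicaB}

/-- The states of the automaton that generates the Brunner–Sidki–Vieira group; the state `dInv`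
is the inverse of `d`. -/
inductive BSVState
  | one | c | d | dInv

/-- The automaton of the recursion `1 = (1, 1)`, `c = (1, c) σ`, `d = (1, d⁻¹) σ`,
`d⁻¹ = (d, 1) σ`. -/
def bsvAutomaton : InvAutomaton 2 BSVState where
  perm
    | .one => 1
    | .c => Equiv.swap 0 1
    | .d => Equiv.swap 0 1
    | .dInv => Equiv.swap 0 1
  next
    | .one => ![.one, .one]
    | .c => ![.one, .c]
    | .d => ![.one, .dInv]
    | .dInv => ![.d, .one]

/-- The generator `c` of the Brunner–Sidki–Vieira group. -/
def bsvC : AutT 2 := bsvAutomaton.toAut .c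

/-- The generator `d` of the Brunner–Sidki–Vieira group. -/
def bsvD : AutT 2 := bsvAutomaton.toAut .d

/-- The Brunner–Sidki–Vieira group, generated by `c` and `d` with `ψ(c) = (1, c) σ` and
`ψ(d) = (1, d⁻¹) σ`. -/
def bsvGroup : Subgroup (AutT 2) := Subgroup.closure {bsvC, bsvD}

/-! The recursions that define the four generators. -/

theorem basilica_act_one (u : List (Fin 2)) : basilicaAutomaton.act .one u = u := by
  induction u with
  | nil => rfl
  | cons x u ih => fin_cases x <;> simpa [InvAutomaton.act, basilicaAutomaton] using ih

theorem bsv_act_one (u : List (Fin 2)) : bsvAutomaton.act .one u = u := by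
  induction u with
  | nil => rfl
  | cons x u ih => fin_cases x <;> simpa [InvAutomaton.act, bsvAutomaton] using ih

theorem bsv_act_dInv (u : List (Fin 2)) :
    bsvAutomaton.act .dInv (bsvAutomaton.act .d u) = u ∧
      bsvAutomaton.act .d (bsvAutomaton.act .dInv u) = u := by
  induction u with
  | nil => exact ⟨rfl, rfl⟩
  | cons x u ih =>
    have h1 : bsvAutomaton.act .one u = u := bsv_act_one u
    have h2 : bsvAutomaton.act .one (bsvAutomaton.act .one u) = u := by rw [h1, h1]
    fin_cases x
    · exact ⟨by
        change (0 : Fin 2) :: bsvAutomaton.act .one (bsvAutomaton.act .one u) = _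
        rw [h2]; rfl, by
        change (0 : Fin 2) :: bsvAutomaton.act .dInv (bsvAutomaton.act .d u) = _
        rw [ih.1]; rfl⟩
    · exact ⟨by
        change (1 : Fin 2) :: bsvAutomaton.act .d (bsvAutomaton.act .dInv u) = _
        rw [ih.2]; rfl, by
        change (1 : Fin 2) :: bsvAutomaton.act .one (bsvAutomaton.act .one u) = _
        rw [h2]; rfl⟩

theorem bsvD_inv : bsvD⁻¹ = bsvAutomaton.toAut .dInv := by
  rw [inv_eq_iff_mul_eq_one]
  exact AutT.app_ext fun u => (bsv_act_dInv u).2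

theorem basilicaA_wreath : HasWreath basilicaA ![1, basilicaB] 1 := by
  intro x u
  fin_cases x
  · exact congrArg (List.cons 0) (basilica_act_one u)
  · rfl

theorem basilicaB_wreath : HasWreath basilicaB ![1, basilicaA] (Equiv.swap 0 1) := by
  intro x u
  fin_cases x
  · exact congrArg (List.cons 1) (basilica_act_one u)
  · rfl

theorem bsvC_wreath : HasWreath bsvC ![1, bsvC] (Equiv.swap 0 1) := by
  intro x u
  fin_cases x
  · exact congrArg (List.cons 1) (bsv_act_one u)
  · rfl

theorem bsvD_wreath : HasWreath bsvD ![1, bsvD⁻¹] (Equiv.swap 0 1) := by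
  intro x u
  fin_cases x
  · exact congrArg (List.cons 1) (bsv_act_one u)
  · rw [bsvD_inv]; rfl

/-! In `basilicaGroup`, `a` commutes with its conjugate by `b`, and `b²` with its conjugate by `a`.
The group `bsvGroup` has a quotient of class three, inside `MomentGroup`, in which no generating
pair satisfies both relations. For generators `x`, `y` of that quotient, the coordinates `(k, y)`
form an integer matrix of determinant `Δ = ±1`. The two commutators are central, with
`u`-coordinates `±2 x.k Δ` and `±8 y.k Δ` modulo 16. If both vanish, `x.k` and `y.k` are even,
although the image of `c` has `k = 1` (`not_mem_closure`). The quotient map is built without a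
presentation: `momentGraph` is generated by the pairs of generators, and it is the graph of a
function once its fibre over `1` is trivial. Sections stay in `momentGraph` (`exists_sections`), so
that fibre is self-similar under `SectionRel 0`, which contracts 2-adically to `1`
(`eq_one_of_sectionRel`). -/

namespace AutT

variable {d : ℕ}

theorem app_mul (g h : AutT d) (v : List (Fin d)) : app (g * h) v = app g (app h v) := rfl

theorem app_one (v : List (Fin d)) : app (1 : AutT d) v = v := rfl

theorem app_nil (g : AutT d) : app g [] = [] := g.2

theorem app_app_inv (g : AutT d) (v : List (Fin d)) : app g (app g⁻¹ v) = v := by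
  rw [← app_mul, mul_inv_cancel, app_one]

theorem app_inv_app (g : AutT d) (v : List (Fin d)) : app g⁻¹ (app g v) = v := by
  rw [← app_mul, inv_mul_cancel, app_one]

end AutT

/-! ### Calculus of the wreath recursion. -/

namespace HasWreath

variable {d : ℕ} {g h : AutT d} {s s' : Fin d → AutT d} {t t' : Equiv.Perm (Fin d)}

theorem one : HasWreath (1 : AutT d) (fun _ => 1) 1 := fun _ _ => rfl

theorem mul (hg : HasWreath g s t) (hh : HasWreath h s' t') :
    HasWreath (g * h) (fun x => s (t' x) * s' x) (t * t') := by
  intro x u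
  rw [AutT.app_mul, hh, hg]
  rfl

theorem inv (hg : HasWreath g s t) : HasWreath g⁻¹ (fun x => (s (t⁻¹ x))⁻¹) t⁻¹ := by
  intro x u
  have key : AutT.app g (t⁻¹ x :: AutT.app (s (t⁻¹ x))⁻¹ u) = x :: u := by
    rw [hg, AutT.app_app_inv, ← Equiv.Perm.mul_apply, mul_inv_cancel, Equiv.Perm.one_apply]
  exact (congrArg (AutT.app g⁻¹) key.symm).trans (AutT.app_inv_app _ _)

theorem ext (hg : HasWreath g s t) (hh : HasWreath h s t) : g = h := by
  refine AutT.app_ext fun v => ?_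
  cases v with
  | nil => rw [AutT.app_nil, AutT.app_nil]
  | cons x u => rw [hg, hh]

theorem perm_eq_one (hg : HasWreath (1 : AutT d) s t) : t = 1 := by
  ext x
  have h := hg x []
  rw [AutT.app_one] at h
  simp only [List.cons.injEq] at h
  simp [← h.1]

theorem section_eq_one (hg : HasWreath (1 : AutT d) s t) (x : Fin d) : s x = 1 := by
  refine AutT.app_ext fun u => ?_
  have h := hg x u
  rw [AutT.app_one] at h
  simp only [List.cons.injEq] at h
  rw [← h.2, AutT.app_one]

end HasWreath

/-! ### The nilpotent target and the section relation. -/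

/-- A nilpotent group of class three: the semidirect product `A ⋊ ℤ`, where `k : ℤ` acts on the
triples `(y, z, u)` in `A = ℤ × ℤ × ZMod 16` in the way in which the translation of `ℤ` by `k` acts
on the moments `(∑ nᵢ, ∑ i nᵢ, ∑ i² nᵢ)` of a finitely supported function `n`. -/
@[ext]
structure MomentGroup where
  k : ℤ
  y : ℤ
  z : ℤ
  u : ZMod 16

namespace MomentGroup

instance : Mul MomentGroup :=
  ⟨fun p q => ⟨p.k + q.k, p.y + q.y, p.z + q.z + p.k * q.y,
    p.u + q.u + 2 * p.k * q.z + p.k ^ 2 * q.y⟩⟩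

instance : One MomentGroup := ⟨⟨0, 0, 0, 0⟩⟩

instance : Inv MomentGroup :=
  ⟨fun p => ⟨-p.k, -p.y, -p.z + p.k * p.y, -p.u + 2 * p.k * p.z - p.k ^ 2 * p.y⟩⟩

@[simp] theorem mul_k (p q : MomentGroup) : (p * q).k = p.k + q.k := rfl
@[simp] theorem mul_y (p q : MomentGroup) : (p * q).y = p.y + q.y := rfl
@[simp] theorem mul_z (p q : MomentGroup) : (p * q).z = p.z + q.z + p.k * q.y := rfl
@[simp] theorem mul_u (p q : MomentGroup) :
    (p * q).u = p.u + q.u + 2 * p.k * q.z + p.k ^ 2 * q.y := rfl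
@[simp] theorem one_k : (1 : MomentGroup).k = 0 := rfl
@[simp] theorem one_y : (1 : MomentGroup).y = 0 := rfl
@[simp] theorem one_z : (1 : MomentGroup).z = 0 := rfl
@[simp] theorem one_u : (1 : MomentGroup).u = 0 := rfl
@[simp] theorem inv_k (p : MomentGroup) : p⁻¹.k = -p.k := rfl
@[simp] theorem inv_y (p : MomentGroup) : p⁻¹.y = -p.y := rfl
@[simp] theorem inv_z (p : MomentGroup) : p⁻¹.z = -p.z + p.k * p.y := rfl
@[simp] theorem inv_u (p : MomentGroup) :
    p⁻¹.u = -p.u + 2 * p.k * p.z - p.k ^ 2 * p.y := rfl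

instance : Group MomentGroup :=
  Group.ofLeftAxioms
    (fun p q r => by
      ext <;> simp <;> ring)
    (fun p => by ext <;> simp)
    (fun p => by ext <;> simp; ring)

/-- The image of the generator `c`. -/
def genC : MomentGroup := ⟨1, 0, 0, 0⟩

/-- The image of the generator `d`. -/
def genD : MomentGroup := ⟨1, 1, 0, 0⟩

/-- The relation between the image `q` of an element `g` of the Brunner–Sidki–Vieira group and the
images of its two sections. If `g` fixes the first level then `e = 0`, and `p₀`, `p₁` are the
images of the sections at `0` and `1`; otherwise `e = 1`, and the two are exchanged. -/
structure SectionRel (e : ℤ) (p₀ p₁ q : MomentGroup) : Prop where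
  k₀ : q.k + e = 2 * (p₀.k - 2 * p₀.y)
  k₁ : q.k - e = 2 * (p₁.k - 2 * p₁.y)
  y : q.y = -p₀.y - p₁.y
  z : q.z = 2 * (p₀.y ^ 2 - p₀.z) + 2 * (p₁.y ^ 2 - p₁.z) - p₁.y
  u : q.u = 4 * (-p₀.u + 2 * (p₀.y ^ 2 - p₀.z) + p₀.y)
    + 4 * (-p₁.u + 2 * (p₁.y ^ 2 - p₁.z) + p₁.y) + 4 * (p₁.y ^ 2 - p₁.z) - p₁.y

namespace SectionRel

theorem one : SectionRel 0 1 1 1 := by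
  constructor <;> simp

variable {p₀ p₁ q : MomentGroup}

theorem sixteen : (16 : ZMod 16) = 0 := rfl

theorem mul_genC_zero (h : SectionRel 0 p₀ p₁ q) : SectionRel 1 (p₀ * genC) p₁ (q * genC) := by
  obtain ⟨hk₀, hk₁, hy, hz, hu⟩ := h
  constructor <;> simp [genC]
  all_goals first | linarith | assumption

theorem mul_genC_one (h : SectionRel 1 p₀ p₁ q) : SectionRel 0 p₀ (p₁ * genC) (q * genC) := by
  obtain ⟨hk₀, hk₁, hy, hz, hu⟩ := h
  constructor <;> simp [genC]
  all_goals first | linarith | assumption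

theorem mul_genC_inv_zero (h : SectionRel 0 p₀ p₁ q) :
    SectionRel 1 p₀ (p₁ * genC⁻¹) (q * genC⁻¹) := by
  obtain ⟨hk₀, hk₁, hy, hz, hu⟩ := h
  constructor <;> simp [genC]
  all_goals first | linarith | assumption

theorem mul_genC_inv_one (h : SectionRel 1 p₀ p₁ q) :
    SectionRel 0 (p₀ * genC⁻¹) p₁ (q * genC⁻¹) := by
  obtain ⟨hk₀, hk₁, hy, hz, hu⟩ := h
  constructor <;> simp [genC]
  all_goals first | linarith | assumption

/-- A letter `d` read at height `q.k = 2(k - 2y)`, with `k`, `y` taken from `p₀`, adds `q.k` to `z`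
and `q.k²` to `u`. The sum of the `y`-terms telescopes to `y²`. In `q.k² = 4k² - 16ky + 16y²` the
mixed term is not determined by the moments, which is why `u` is taken modulo 16. -/
theorem mul_genD_zero (h : SectionRel 0 p₀ p₁ q) :
    SectionRel 1 (p₀ * genD⁻¹) p₁ (q * genD) := by
  obtain ⟨hk₀, hk₁, hy, hz, hu⟩ := h
  have hk : q.k = 2 * (p₀.k - 2 * p₀.y) := by linarith
  constructor <;> simp [genD]
  · linarith
  · linarith
  · linarith
  · rw [hz, hk]; ring
  · rw [hu, hk]
    push_cast
    linear_combination (p₀.y ^ 2 - p₀.k * p₀.y + p₀.y) * sixteen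

theorem mul_genD_one (h : SectionRel 1 p₀ p₁ q) :
    SectionRel 0 p₀ (p₁ * genD⁻¹) (q * genD) := by
  obtain ⟨hk₀, hk₁, hy, hz, hu⟩ := h
  have hk : q.k = 2 * (p₁.k - 2 * p₁.y) + 1 := by linarith
  constructor <;> simp [genD]
  · linarith
  · linarith
  · linarith
  · rw [hz, hk]; ring
  · rw [hu, hk]
    push_cast
    linear_combination (p₁.y ^ 2 - p₁.k * p₁.y + p₁.y) * sixteen

theorem mul_genD_inv_zero (h : SectionRel 0 p₀ p₁ q) :
    SectionRel 1 p₀ (p₁ * genD) (q * genD⁻¹) := by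
  obtain ⟨hk₀, hk₁, hy, hz, hu⟩ := h
  have hk : q.k = 2 * (p₁.k - 2 * p₁.y) := by linarith
  constructor <;> simp [genD]
  · linarith
  · linarith
  · linarith
  · rw [hz, hk]; ring
  · rw [hu, hk]
    push_cast
    linear_combination (-p₁.y ^ 2 + p₁.k * p₁.y - 2 * p₁.y + p₁.k - 1) * sixteen

theorem mul_genD_inv_one (h : SectionRel 1 p₀ p₁ q) :
    SectionRel 0 (p₀ * genD) p₁ (q * genD⁻¹) := by
  obtain ⟨hk₀, hk₁, hy, hz, hu⟩ := h
  have hk : q.k = 2 * (p₀.k - 2 * p₀.y) - 1 := by linarith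
  constructor <;> simp [genD]
  · linarith
  · linarith
  · linarith
  · rw [hz, hk]; ring
  · rw [hu, hk]
    push_cast
    linear_combination (-p₀.y ^ 2 + p₀.k * p₀.y - 2 * p₀.y + p₀.k - 1) * sixteen

end SectionRel

/-- A set of elements whose members all arise from two members of the set by the relation
`SectionRel 0` is trivial. -/
theorem eq_one_of_sectionRel {K : Set MomentGroup}
    (hK : ∀ q ∈ K, ∃ p₀ ∈ K, ∃ p₁ ∈ K, SectionRel 0 p₀ p₁ q) : ∀ q ∈ K, q = 1 := by
  have eq_zero {m : ℤ} (h : ∀ n : ℕ, (2 : ℤ) ^ n ∣ m) : m = 0 := by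
    by_contra hm
    obtain ⟨n, hn⟩ := (Int.finiteMultiplicity_iff.2 ⟨by decide, hm⟩ : FiniteMultiplicity (2 : ℤ) m)
    exact hn (h _)
  have kdvd (n : ℕ) : ∀ q ∈ K, (2 : ℤ) ^ n ∣ q.k := by
    induction n with
    | zero => simp
    | succ n ih =>
      intro q hq
      obtain ⟨p₀, h₀, p₁, h₁, h⟩ := hK q hq
      -- One level gives only `q.k = 2(p₀.k - 2 p₀.y)`; the second level rewrites `p₀.k - 2 p₀.y` as
      -- `r₀.k + r₁.k`, so the induction involves `k` alone.
      obtain ⟨r₀, hr₀, r₁, hr₁, h'⟩ := hK p₀ h₀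
      have e₁ := h'.k₀
      have e₂ := h'.k₁
      have e₃ := h'.y
      have e : 2 * p₀.y = p₀.k - r₀.k - r₁.k := by linarith
      have e₄ := h.k₀
      have e' : q.k = (r₀.k + r₁.k) * 2 := by linarith
      rw [e', pow_succ]
      exact mul_dvd_mul_right (dvd_add (ih _ hr₀) (ih _ hr₁)) 2
  have k0 : ∀ q ∈ K, q.k = 0 := fun q hq => eq_zero fun n => kdvd n q hq
  have y0 : ∀ q ∈ K, q.y = 0 := by
    intro q hq
    obtain ⟨p₀, h₀, p₁, h₁, h⟩ := hK q hq
    have e₁ := h.k₀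
    have e₂ := h.k₁
    have e₃ := h.y
    have := k0 q hq
    have := k0 _ h₀
    have := k0 _ h₁
    linarith
  have zdvd (n : ℕ) : ∀ q ∈ K, (2 : ℤ) ^ n ∣ q.z := by
    induction n with
    | zero => simp
    | succ n ih =>
      intro q hq
      obtain ⟨p₀, h₀, p₁, h₁, h⟩ := hK q hq
      have e : q.z = (-(p₀.z + p₁.z)) * 2 := by
        rw [h.z, y0 _ h₀, y0 _ h₁]; ring
      rw [e, pow_succ]
      exact mul_dvd_mul_right (dvd_neg.2 (dvd_add (ih _ h₀) (ih _ h₁))) 2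
  have z0 : ∀ q ∈ K, q.z = 0 := fun q hq => eq_zero fun n => zdvd n q hq
  have u_eq : ∀ q ∈ K, ∃ p₀ ∈ K, ∃ p₁ ∈ K, q.u = -4 * (p₀.u + p₁.u) := by
    intro q hq
    obtain ⟨p₀, h₀, p₁, h₁, h⟩ := hK q hq
    refine ⟨p₀, h₀, p₁, h₁, ?_⟩
    rw [h.u, y0 _ h₀, y0 _ h₁, z0 _ h₀, z0 _ h₁]
    push_cast
    ring
  intro q hq
  ext
  · exact k0 q hq
  · exact y0 q hq
  · exact z0 q hq
  · obtain ⟨p₀, h₀, p₁, h₁, h⟩ := u_eq q hq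
    -- Each level contributes a factor `-4`, so two levels give a multiple of 16.
    obtain ⟨r₀, -, r₁, -, h'⟩ := u_eq _ h₀
    obtain ⟨s₀, -, s₁, -, h''⟩ := u_eq _ h₁
    rw [one_u, h, h', h'']
    linear_combination (r₀.u + r₁.u + s₀.u + s₁.u) * SectionRel.sixteen

end MomentGroup

/-! ### The homomorphism from the Brunner–Sidki–Vieira group. -/

open MomentGroup

/-- The graph of the homomorphism from the Brunner–Sidki–Vieira group to `MomentGroup`. -/
def momentGraph : Subgroup (AutT 2 × MomentGroup) :=
  Subgroup.closure {(bsvC, genC), (bsvD, genD)}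

theorem bsvC_genC_mem : (bsvC, genC) ∈ momentGraph := Subgroup.subset_closure (by simp)

theorem bsvD_genD_mem : (bsvD, genD) ∈ momentGraph := Subgroup.subset_closure (by simp)

/-- Right multiplication by a generator or its inverse swaps the two sections and multiplies just
one of them by a generator or its inverse, so both remain in `momentGraph`. -/
theorem exists_sections {x : AutT 2 × MomentGroup} (hx : x ∈ momentGraph) :
    ∃ (s : Fin 2 → AutT 2) (p₀ p₁ : MomentGroup),
      (HasWreath x.1 s 1 ∧ SectionRel 0 p₀ p₁ x.2 ∧
        (s 0, p₀) ∈ momentGraph ∧ (s 1, p₁) ∈ momentGraph) ∨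
      (HasWreath x.1 s (Equiv.swap 0 1) ∧ SectionRel 1 p₀ p₁ x.2 ∧
        (s 1, p₀) ∈ momentGraph ∧ (s 0, p₁) ∈ momentGraph) := by
  have hC := bsvC_genC_mem
  have hD := bsvD_genD_mem
  have hC' := inv_mem hC
  have hD' := inv_mem hD
  have σσ : (Equiv.swap 0 1 : Equiv.Perm (Fin 2)) * Equiv.swap 0 1 = 1 := by decide
  induction hx using Subgroup.closure_induction_right with
  | one =>
    exact ⟨fun _ => 1, 1, 1, .inl ⟨HasWreath.one, SectionRel.one, one_mem _, one_mem _⟩⟩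
  | mul_right x hx g hg ih =>
    obtain ⟨s, p₀, p₁, ⟨hw, hr, h₀, h₁⟩ | ⟨hw, hr, h₀, h₁⟩⟩ := ih
    · rcases hg with rfl | rfl
      · refine ⟨_, _, _, .inr ⟨hw.mul bsvC_wreath, hr.mul_genC_zero, ?_, ?_⟩⟩
        · simpa using mul_mem h₀ hC
        · simpa using h₁
      · refine ⟨_, _, _, .inr ⟨hw.mul bsvD_wreath, hr.mul_genD_zero, ?_, ?_⟩⟩
        · simpa using mul_mem h₀ hD'
        · simpa using h₁
    · rcases hg with rfl | rfl
      · refine ⟨_, _, _, .inl ⟨σσ ▸ hw.mul bsvC_wreath, hr.mul_genC_one, ?_, ?_⟩⟩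
        · simpa using h₀
        · simpa using mul_mem h₁ hC
      · refine ⟨_, _, _, .inl ⟨σσ ▸ hw.mul bsvD_wreath, hr.mul_genD_one, ?_, ?_⟩⟩
        · simpa using h₀
        · simpa using mul_mem h₁ hD'
  | mul_inv_cancel x hx g hg ih =>
    obtain ⟨s, p₀, p₁, ⟨hw, hr, h₀, h₁⟩ | ⟨hw, hr, h₀, h₁⟩⟩ := ih
    · rcases hg with rfl | rfl
      · refine ⟨_, _, _, .inr ⟨hw.mul bsvC_wreath.inv, hr.mul_genC_inv_zero, ?_, ?_⟩⟩
        · simpa using h₀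
        · simpa using mul_mem h₁ hC'
      · refine ⟨_, _, _, .inr ⟨hw.mul bsvD_wreath.inv, hr.mul_genD_inv_zero, ?_, ?_⟩⟩
        · simpa using h₀
        · simpa using mul_mem h₁ hD
    · rcases hg with rfl | rfl
      · refine ⟨_, _, _, .inl ⟨σσ ▸ hw.mul bsvC_wreath.inv, hr.mul_genC_inv_one, ?_, ?_⟩⟩
        · simpa using mul_mem h₀ hC'
        · simpa using h₁
      · refine ⟨_, _, _, .inl ⟨σσ ▸ hw.mul bsvD_wreath.inv, hr.mul_genD_inv_one, ?_, ?_⟩⟩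
        · simpa using mul_mem h₀ hD
        · simpa using h₁

theorem momentGraph_eq_one {q : MomentGroup} (hq : (1, q) ∈ momentGraph) : q = 1 := by
  refine eq_one_of_sectionRel (K := {q | (1, q) ∈ momentGraph}) (fun q hq => ?_) q hq
  obtain ⟨s, p₀, p₁, ⟨hw, hr, h₀, h₁⟩ | ⟨hw, -⟩⟩ := exists_sections hq
  · rw [hw.section_eq_one] at h₀ h₁
    exact ⟨p₀, h₀, p₁, h₁, hr⟩
  · exact absurd hw.perm_eq_one (by decide)

theorem exists_mem_momentGraph {g : AutT 2} (hg : g ∈ bsvGroup) :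
    ∃ q, (g, q) ∈ momentGraph := by
  have h : bsvGroup = momentGraph.map (MonoidHom.fst (AutT 2) MomentGroup) := by
    rw [bsvGroup, momentGraph, MonoidHom.map_closure, Set.image_pair]
    rfl
  rw [h] at hg
  obtain ⟨⟨g, q⟩, hq, rfl⟩ := hg
  exact ⟨q, hq⟩

theorem momentGraph_unique {g : AutT 2} {p q : MomentGroup} (hp : (g, p) ∈ momentGraph)
    (hq : (g, q) ∈ momentGraph) : p = q := by
  have h := mul_mem hp (inv_mem hq)
  rw [Prod.inv_mk, Prod.mk_mul_mk, mul_inv_cancel] at h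
  exact mul_inv_eq_one.1 (momentGraph_eq_one h)

theorem exists_bsvGroup_hom : ∃ f : bsvGroup →* MomentGroup,
    genC ∈ f.range ∧ genD ∈ f.range := by
  choose F hF using fun g : bsvGroup => exists_mem_momentGraph g.2
  refine ⟨MonoidHom.mk' F fun g h => momentGraph_unique (hF _) (mul_mem (hF g) (hF h)),
    ⟨⟨bsvC, Subgroup.subset_closure (by simp)⟩, ?_⟩,
    ⟨⟨bsvD, Subgroup.subset_closure (by simp)⟩, ?_⟩⟩
  · exact momentGraph_unique (hF _) bsvC_genC_mem
  · exact momentGraph_unique (hF _) bsvD_genD_mem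

/-! ### Two relations in the Basilica group. -/

/-- Here `a = (1, b)` and `b a b⁻¹ = (a b a⁻¹, 1)` act on different subtrees. -/
theorem basilica_commute_a : Commute basilicaA (basilicaB * basilicaA * basilicaB⁻¹) := by
  have hc := (basilicaB_wreath.mul basilicaA_wreath).mul basilicaB_wreath.inv
  refine (basilicaA_wreath.mul hc).ext ?_
  convert hc.mul basilicaA_wreath using 1
  · ext x : 1
    fin_cases x <;> simp
  · decide

/-- Since `b² = (a, a)` and `a b² a⁻¹ = (a, b a b⁻¹)`, the claim reduces to `basilica_commute_a` in
the second coordinate. -/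
theorem basilica_commute_b :
    Commute (basilicaB * basilicaB) (basilicaA * (basilicaB * basilicaB) * basilicaA⁻¹) := by
  have hb := basilicaB_wreath.mul basilicaB_wreath
  have hc := (basilicaA_wreath.mul hb).mul basilicaA_wreath.inv
  refine (hb.mul hc).ext ?_
  convert hc.mul hb using 1
  · ext x : 1
    fin_cases x
    · simp
    · simpa using basilica_commute_a.eq
  · decide

/-! ### Generating pairs cannot satisfy both relations. -/

namespace MomentGroup

theorem exists_combination {x y g : MomentGroup} (hg : g ∈ Subgroup.closure {x, y}) :
    ∃ m n : ℤ, g.k = m * x.k + n * y.k ∧ g.y = m * x.y + n * y.y := by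
  induction hg using Subgroup.closure_induction with
  | mem g hg =>
    rcases hg with rfl | rfl
    · exact ⟨1, 0, by ring, by ring⟩
    · exact ⟨0, 1, by ring, by ring⟩
  | one => exact ⟨0, 0, by simp, by simp⟩
  | mul g h _ _ ihg ihh =>
    obtain ⟨m, n, h₁, h₂⟩ := ihg
    obtain ⟨m', n', h₃, h₄⟩ := ihh
    exact ⟨m + m', n + n', by rw [mul_k, h₁, h₃]; ring, by rw [mul_y, h₂, h₄]; ring⟩
  | inv g _ ih =>
    obtain ⟨m, n, h₁, h₂⟩ := ih
    exact ⟨-m, -n, by rw [inv_k, h₁]; ring, by rw [inv_y, h₂]; ring⟩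

theorem not_mem_closure {x y : MomentGroup} (hx : Commute x (y * x * y⁻¹))
    (hy : Commute (y * y) (x * (y * y) * x⁻¹)) (hC : genC ∈ Subgroup.closure {x, y}) :
    genD ∉ Subgroup.closure {x, y} := by
  intro hD
  obtain ⟨m, n, h₁, h₂⟩ := exists_combination hC
  obtain ⟨m', n', h₃, h₄⟩ := exists_combination hD
  simp only [genC, genD] at h₁ h₂ h₃ h₄
  -- The rows `(1, 0)` and `(1, 1)` of `genC` and `genD` are integer combinations of the rows of `x`
  -- and `y`, and their determinant is 1.
  have hdet : (m * n' - n * m') * (x.k * y.y - y.k * x.y) = 1 := by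
    linear_combination (m' * x.y + n' * y.y) * (-h₁) + (m' * x.k + n' * y.k) * h₂ - h₄
  have hu := congrArg MomentGroup.u hx.eq
  have hv := congrArg MomentGroup.u hy.eq
  simp only [mul_u, mul_k, mul_y, mul_z, inv_u, inv_k, inv_y, inv_z] at hu hv
  have hu' : ((2 * x.k * (x.k * y.y - y.k * x.y) : ℤ) : ZMod 16) = 0 := by
    push_cast at hu ⊢
    linear_combination -hu
  have hv' : ((8 * y.k * (x.k * y.y - y.k * x.y) : ℤ) : ZMod 16) = 0 := by
    push_cast at hv ⊢
    linear_combination hv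
  rw [ZMod.intCast_zmod_eq_zero_iff_dvd] at hu' hv'
  -- Multiplying by the inverse `m n' - n m'` of the determinant removes it from the divisibility.
  have e₁ : (16 : ℤ) ∣ 2 * x.k := by
    have := dvd_mul_of_dvd_left hu' (m * n' - n * m')
    rwa [show 2 * x.k * (x.k * y.y - y.k * x.y) * (m * n' - n * m') = 2 * x.k by
      linear_combination 2 * x.k * hdet] at this
  have e₂ : (16 : ℤ) ∣ 8 * y.k := by
    have := dvd_mul_of_dvd_left hv' (m * n' - n * m')
    rwa [show 8 * y.k * (x.k * y.y - y.k * x.y) * (m * n' - n * m') = 8 * y.k by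
      linear_combination 8 * y.k * hdet] at this
  have d₁ : (2 : ℤ) ∣ x.k := by omega
  have d₂ : (2 : ℤ) ∣ y.k := by omega
  have : (2 : ℤ) ∣ 1 := h₁ ▸ dvd_add (dvd_mul_of_dvd_right d₁ m) (dvd_mul_of_dvd_right d₂ n)
  omega

end MomentGroup

theorem mainTheorem9 : ¬ Nonempty (basilicaGroup ≃* bsvGroup) := by
  rintro ⟨e⟩
  obtain ⟨f, hC, hD⟩ := exists_bsvGroup_hom
  let a : basilicaGroup := ⟨basilicaA, Subgroup.subset_closure (by simp)⟩
  let b : basilicaGroup := ⟨basilicaB, Subgroup.subset_closure (by simp)⟩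
  have hab : Subgroup.closure {a, b} = ⊤ := by
    have h := Subgroup.closure_closure_coe_preimage
      (k := ({basilicaA, basilicaB} : Set (AutT 2)))
    refine Eq.trans ?_ h
    congr 1
    ext g
    exact or_congr Subtype.ext_iff Subtype.ext_iff
  let F : basilicaGroup →* MomentGroup := f.comp e.toMonoidHom
  have hF : F.range = f.range := by
    rw [MonoidHom.range_comp, MonoidHom.range_eq_top.2 e.surjective, ← MonoidHom.range_eq_map]
  have hcl : F.range = Subgroup.closure {F a, F b} := by
    rw [MonoidHom.range_eq_map, ← hab, MonoidHom.map_closure, Set.image_pair]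
  rw [← hF, hcl] at hC hD
  have ha : Commute a (b * a * b⁻¹) := Subtype.ext basilica_commute_a.eq
  have hb : Commute (b * b) (a * (b * b) * a⁻¹) := Subtype.ext basilica_commute_b.eq
  refine not_mem_closure ?_ ?_ hC hD
  · simpa using ha.map F
  · simpa using hb.map F
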